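/- A configuration $\eta\in\{0,1,2,\dots\}^{\mathbb Z}$ assigns a height to each site of $\mathbb Z$; a site $x$ is called active (unstable) if $\eta(x)\ge 2$. In one parallel time step of the classical sandpile on $\mathbb Z$, all active sites topple simultaneously, each exactly once, where a toppling of $x$ decreases the height of $x$ by $2$ and increases the heights of $x-1$ and of $x+1$ by $1$ each. For $\rho\ge 0$ let the initial heights be independent Poisson($\rho$) random variables, with joint law $\mu_\rho$, and let $\eta^t$ be the configuration after $t$ parallel time steps. Then for every $\rho\ge 0$ and every integer $t\ge 0$ there is a (unique) constant $\alpha_\rho(t)$ such that, $\mu_\rho$-almost surely, $$\alpha_\rho(t)=\lim_{n\to\infty}\frac{\#\{x\in[-n,n]\cap\mathbb Z:\ \eta^t(x)\ge 2\}}{2n+1},$$ and the following hold. 1. For $\rho<1$, $\lim_{t\to\infty}\alpha_\rho(t)=0$. 2. For $\rho>2$, $\lim_{t\to\infty}\alpha_\rho(t)=1$. 3. For $1<\rho<2$, $\lim_{T\to\infty}\frac1T\sum_{t=1}^T\alpha_\rho(t)=\frac12$. -/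

import Mathlib

open MeasureTheory ProbabilityTheory Filter
open scoped NNReal Topology

namespace Sandpile

/-- A site is active (unstable) in the height configuration `η` if its height is at least 2. -/
def Active (η : ℤ → ℕ) (x : ℤ) : Prop := 2 ≤ η x

instance (η : ℤ → ℕ) : DecidablePred (Active η) := fun x => Nat.decLe 2 (η x)

/-- One parallel time step of the classical sandpile on `ℤ`: every active site topples exactly
once, losing two particles and sending one of them to each of its two neighbours. -/
def step (η : ℤ → ℕ) (x : ℤ) : ℕ :=
  (if Active η x then η x - 2 else η x)
    + (if Active η (x - 1) then 1 else 0)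
    + (if Active η (x + 1) then 1 else 0)

/-- The configuration after `t` parallel time steps started from `η`. -/
def evolve (t : ℕ) (η : ℤ → ℕ) : ℤ → ℕ := step^[t] η

/-- The fraction of active sites among the `2n + 1` sites of `[-n, n]`. -/
noncomputable def activeFraction (n : ℕ) (η : ℤ → ℕ) : ℝ :=
  (((Finset.Icc (-(n : ℤ)) n).filter (Active η)).card : ℝ) / (2 * n + 1)

/-- The law of the initial configuration: independent Poisson(`ρ`) heights at the sites of `ℤ`. -/
noncomputable def initialLaw (ρ : ℝ≥0) : Measure (ℤ → ℕ) :=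
  Measure.infinitePi (fun _ : ℤ => poissonMeasure ρ)

/-- `a` is the density of active sites at time `t`: for almost every initial configuration, the
fraction of active sites in `[-n, n]` at time `t` converges to the constant `a` as `n → ∞`.
As `initialLaw ρ` is a probability measure, there is at most one such `a`. -/
def IsActivityDensity (ρ : ℝ≥0) (t : ℕ) (a : ℝ) : Prop :=
  ∀ᵐ η ∂(initialLaw ρ), Tendsto (fun n : ℕ => activeFraction n (evolve t η)) atTop (𝓝 a)

end Sandpile

namespace Sandpile

/-! ### Toppling counts for integer-valued configurations -/

/-- The discrete Laplacian on `ℤ`. -/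
def laplacian (v : ℤ → ℤ) (x : ℤ) : ℤ := v (x - 1) + v (x + 1) - 2 * v x

/-- `W t x` counts the topplings of `x` before time `t` in the parallel sandpile started from the
integer-valued configuration `ζ`. -/
structure IsOdometer (ζ : ℤ → ℤ) (W : ℕ → ℤ → ℤ) : Prop where
  zero : ∀ x, W 0 x = 0
  succ : ∀ t x, W (t + 1) x = W t x + if 2 ≤ ζ x + laplacian (W t) x then 1 else 0

/-- Least action principle: a nonnegative stabilizing function dominates the odometer. -/
theorem IsOdometer.le_of_stabilizing {ζ : ℤ → ℤ} {W : ℕ → ℤ → ℤ} (hW : IsOdometer ζ W)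
    {v : ℤ → ℤ} (hv : ∀ x, 0 ≤ v x) (hs : ∀ x, ζ x + laplacian v x ≤ 1) (t : ℕ) (x : ℤ) :
    W t x ≤ v x := by
  induction t generalizing x with
  | zero => rw [hW.zero]; exact hv x
  | succ t ih =>
    have h0 := ih x
    have h1 := ih (x - 1)
    have h2 := ih (x + 1)
    have h3 := hs x
    rw [hW.succ]
    unfold laplacian at *
    split_ifs <;> omega

/-- If adding `-v` leaves `2` particles on odd sites and none on even sites, then the odometer
dominates that of the alternating toppling of odd and even sites, up to `v`. -/
theorem IsOdometer.alternating_sub_le {ζ : ℤ → ℤ} {W : ℕ → ℤ → ℤ} (hW : IsOdometer ζ W)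
    {v : ℤ → ℤ} (hv : ∀ x, 0 ≤ v x) (hs : ∀ x, laplacian v x = ζ x - 2 * (x % 2))
    (t : ℕ) (x : ℤ) : (t + x % 2) / 2 - v x ≤ W t x := by
  induction t generalizing x with
  | zero => rw [hW.zero]; have := hv x; simp only [Nat.cast_zero]; omega
  | succ t ih =>
    have h0 := ih x
    have h1 := ih (x - 1)
    have h2 := ih (x + 1)
    have h3 := hs x
    rw [hW.succ]
    unfold laplacian at *
    push_cast
    split_ifs <;> omega

/-- The number of topplings at `x` before time `t`. -/
def odometer (η : ℤ → ℕ) (t : ℕ) (x : ℤ) : ℤ :=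
  ∑ s ∈ Finset.range t, if Active (evolve s η) x then 1 else 0

theorem evolve_succ (t : ℕ) (η : ℤ → ℕ) : evolve (t + 1) η = step (evolve t η) :=
  Function.iterate_succ_apply' step t η

theorem odometer_succ (η : ℤ → ℕ) (t : ℕ) (x : ℤ) :
    odometer η (t + 1) x = odometer η t x + if Active (evolve t η) x then 1 else 0 :=
  Finset.sum_range_succ _ _

theorem cast_evolve (η : ℤ → ℕ) (t : ℕ) (x : ℤ) :
    (evolve t η x : ℤ) = η x + laplacian (odometer η t) x := by
  induction t generalizing x with
  | zero => simp [evolve, odometer, laplacian]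
  | succ t ih =>
    have h := ih x
    rw [evolve_succ]
    unfold laplacian at *
    simp only [odometer_succ]
    unfold step
    by_cases hx : Active (evolve t η) x
    · have : 2 ≤ evolve t η x := hx
      simp only [hx, if_true]
      push_cast [this]
      linarith
    · simp only [hx, if_false]
      push_cast
      linarith

theorem isOdometer_odometer (η : ℤ → ℕ) : IsOdometer (fun x => η x) (odometer η) where
  zero x := by simp [odometer]
  succ t x := by
    rw [odometer_succ, ← cast_evolve]
    simp [Active]

/-- The counts of idle steps are the odometer of the configuration with particles and holes
exchanged. -/
theorem isOdometer_idle (η : ℤ → ℕ) :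
    IsOdometer (fun x => 3 - η x) (fun t x => t - odometer η t x) where
  zero x := by simp [odometer]
  succ t x := by
    have h := cast_evolve η t x
    rw [odometer_succ]
    unfold laplacian at *
    unfold Active
    push_cast
    split_ifs <;> omega

/-! ### Solving the discrete Poisson equation -/

theorem bddBelow_sum_range_of_eventually_nonneg {g : ℕ → ℤ} (hg : ∀ᶠ n in atTop, 0 ≤ g n) :
    ∃ M : ℤ, ∀ n, -M ≤ ∑ k ∈ Finset.range n, g k := by
  obtain ⟨N, hN⟩ := eventually_atTop.1 hg
  refine ⟨∑ k ∈ Finset.range N, |g k|, fun n => ?_⟩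
  induction n with
  | zero => simp [Finset.sum_nonneg]
  | succ n ih =>
    rcases le_or_gt N n with h | h
    · rw [Finset.sum_range_succ]; linarith [hN n h]
    · calc -∑ k ∈ Finset.range N, |g k| ≤ -∑ k ∈ Finset.range (n + 1), |g k| :=
            neg_le_neg (Finset.sum_le_sum_of_subset_of_nonneg (by simpa using h)
              fun _ _ _ => abs_nonneg _)
        _ ≤ ∑ k ∈ Finset.range (n + 1), g k := by
            rw [← Finset.sum_neg_distrib]
            exact Finset.sum_le_sum fun k _ => neg_abs_le _

theorem exists_nonneg_laplacian_eq {f : ℤ → ℤ}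
    (hr : ∀ᶠ n : ℕ in atTop, 0 ≤ ∑ k ∈ Finset.range n, f k)
    (hl : ∀ᶠ n : ℕ in atTop, 0 ≤ ∑ k ∈ Finset.range n, f (-1 - k)) :
    ∃ v : ℤ → ℤ, (∀ x, 0 ≤ v x) ∧ ∀ x, laplacian v x = f x := by
  let R : ℕ → ℤ := fun n => ∑ m ∈ Finset.range n, ∑ k ∈ Finset.range (m + 1), f k
  let L : ℕ → ℤ := fun n => ∑ m ∈ Finset.range n, ∑ k ∈ Finset.range (m + 1), f (-1 - k)
  obtain ⟨A, hA⟩ := bddBelow_sum_range_of_eventually_nonneg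
    ((tendsto_add_atTop_nat 1).eventually hr)
  obtain ⟨B, hB⟩ := bddBelow_sum_range_of_eventually_nonneg
    ((tendsto_add_atTop_nat 1).eventually hl)
  have hR : ∀ n : ℕ, R n + R (n + 2) - 2 * R (n + 1) = f (n + 1) := fun n => by
    simp only [R, Finset.sum_range_succ]; push_cast; ring
  have hL : ∀ n : ℕ, L n + L (n + 2) - 2 * L (n + 1) = f (-1 - (n + 1)) := fun n => by
    simp only [L, Finset.sum_range_succ]; push_cast; ring
  let v : ℤ → ℤ := fun x => max A B + if 0 ≤ x then R x.toNat else L (-1 - x).toNat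
  have hvR : ∀ n : ℕ, v n = max A B + R n := fun n => by simp [v]
  have hvL : ∀ n : ℕ, v (-1 - n) = max A B + L n := fun n => by
    have h : ¬ (0 : ℤ) ≤ -1 - n := by omega
    simp only [v, h, if_false]; congr; omega
  have hcase : ∀ x : ℤ, (∃ n : ℕ, x = n) ∨ ∃ n : ℕ, x = -1 - n := fun x => by
    rcases le_or_gt 0 x with h | h
    · exact Or.inl ⟨x.toNat, by omega⟩
    · exact Or.inr ⟨(-1 - x).toNat, by omega⟩
  refine ⟨v, fun x => ?_, fun x => ?_⟩
  · rcases hcase x with ⟨n, rfl⟩ | ⟨n, rfl⟩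
    · rw [hvR]; have := hA n; have := le_max_left A B; simp only [R]; linarith
    · rw [hvL]; have := hB n; have := le_max_right A B; simp only [L]; linarith
  · unfold laplacian
    rcases hcase x with ⟨n, rfl⟩ | ⟨n, rfl⟩
    · cases n with
      | zero =>
        have h1 := hvL 0
        have h2 := hvR 0
        have h3 := hvR 1
        simp only [R, L, Finset.sum_range_succ, Finset.sum_range_zero] at h1 h2 h3
        push_cast at *
        simp only [zero_add] at *
        linarith
      | succ n =>
        have h1 := hvR n
        have h2 := hvR (n + 1)
        have h3 := hvR (n + 2)
        have h4 := hR n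
        push_cast at *
        rw [show (n : ℤ) + 1 - 1 = n by ring, show (n : ℤ) + 1 + 1 = n + 2 by ring]
        linarith
    · cases n with
      | zero =>
        have h1 := hvL 0
        have h2 := hvR 0
        have h3 := hvL 1
        simp only [R, L, Finset.sum_range_succ, Finset.sum_range_zero] at h1 h2 h3
        push_cast at *
        simp only [zero_add] at *
        linarith
      | succ n =>
        have h1 := hvL n
        have h2 := hvL (n + 1)
        have h3 := hvL (n + 2)
        have h4 := hL n
        push_cast at *
        rw [show -1 - ((n : ℤ) + 1) - 1 = -1 - (n + 2) by ring,
          show -1 - ((n : ℤ) + 1) + 1 = -1 - n by ring]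
        linarith

/-! ### Configurations with a mean height -/

/-- The averages of `ζ` over `[0, n)` and over `[-n, 0)` both tend to `m`. -/
structure HasMean (ζ : ℤ → ℤ) (m : ℝ) : Prop where
  right : Tendsto (fun n : ℕ => (∑ k ∈ Finset.range n, (ζ k : ℝ)) / n) atTop (𝓝 m)
  left : Tendsto (fun n : ℕ => (∑ k ∈ Finset.range n, (ζ (-1 - k) : ℝ)) / n) atTop (𝓝 m)

theorem tendsto_average_const_sub {g : ℕ → ℝ} {m : ℝ} (c : ℝ)
    (h : Tendsto (fun n : ℕ => (∑ k ∈ Finset.range n, g k) / n) atTop (𝓝 m)) :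
    Tendsto (fun n : ℕ => (∑ k ∈ Finset.range n, (c - g k)) / n) atTop (𝓝 (c - m)) := by
  refine (h.const_sub c).congr' ?_
  filter_upwards [eventually_gt_atTop 0] with n hn
  have : (n : ℝ) ≠ 0 := by positivity
  simp only [Finset.sum_sub_distrib, Finset.sum_const, Finset.card_range, nsmul_eq_mul]
  field_simp

theorem HasMean.const_sub {ζ : ℤ → ℤ} {m : ℝ} (h : HasMean ζ m) (c : ℤ) :
    HasMean (fun x => c - ζ x) (c - m) where
  right := by push_cast; exact tendsto_average_const_sub c h.right
  left := by push_cast; exact tendsto_average_const_sub c h.left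

theorem tendsto_sum_atTop_of_tendsto_average {g : ℕ → ℤ} {l : ℝ} (hl : 0 < l)
    (h : Tendsto (fun n : ℕ => (∑ k ∈ Finset.range n, (g k : ℝ)) / n) atTop (𝓝 l)) :
    Tendsto (fun n : ℕ => ∑ k ∈ Finset.range n, g k) atTop atTop := by
  rw [← tendsto_intCast_atTop_iff (R := ℝ)]
  refine (h.pos_mul_atTop hl tendsto_natCast_atTop_atTop).congr' ?_
  filter_upwards [eventually_gt_atTop 0] with n hn
  have : (n : ℝ) ≠ 0 := by positivity
  push_cast
  field_simp

/-- Below mean height one every site topples finitely often. -/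
theorem IsOdometer.exists_bound {ζ : ℤ → ℤ} {W : ℕ → ℤ → ℤ} (hW : IsOdometer ζ W) {m : ℝ}
    (hm : HasMean ζ m) (h1 : m < 1) : ∃ v : ℤ → ℤ, ∀ t x, W t x ≤ v x := by
  have h := hm.const_sub 1
  have hpos : 0 < ((1 : ℤ) : ℝ) - m := by push_cast; linarith
  obtain ⟨v, hv, hΔ⟩ := exists_nonneg_laplacian_eq (f := fun x => 1 - ζ x)
    ((tendsto_sum_atTop_of_tendsto_average hpos h.right).eventually_ge_atTop 0)
    ((tendsto_sum_atTop_of_tendsto_average hpos h.left).eventually_ge_atTop 0)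
  exact ⟨v, hW.le_of_stabilizing hv fun x => by rw [hΔ]; omega⟩

/-- Above mean height one every site topples at least every other step, up to a bounded error. -/
theorem IsOdometer.exists_half_le {ζ : ℤ → ℤ} {W : ℕ → ℤ → ℤ} (hW : IsOdometer ζ W) {m : ℝ}
    (hm : HasMean ζ m) (h1 : 1 < m) :
    ∃ v : ℤ → ℤ, ∀ (t : ℕ) x, (t + x % 2) / 2 - v x ≤ W t x := by
  have h := (hm.const_sub 1).const_sub 0
  have hpos : 0 < ((0 : ℤ) : ℝ) - (((1 : ℤ) : ℝ) - m) := by push_cast; linarith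
  have hr : ∀ n : ℕ, ∑ k ∈ Finset.range n, (0 - (1 - ζ k)) ≤
      ∑ k ∈ Finset.range n, (ζ k - 2 * ((k : ℤ) % 2)) := fun n => by
    suffices ∑ k ∈ Finset.range n, (ζ k - 2 * ((k : ℤ) % 2)) =
      ∑ k ∈ Finset.range n, (0 - (1 - ζ k)) + (n : ℤ) % 2 by omega
    induction n with
    | zero => simp
    | succ n ih => rw [Finset.sum_range_succ, ih, Finset.sum_range_succ]; push_cast; omega
  have hl : ∀ n : ℕ, ∑ k ∈ Finset.range n, (0 - (1 - ζ (-1 - k))) - 1 ≤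
      ∑ k ∈ Finset.range n, (ζ (-1 - k) - 2 * ((-1 - (k : ℤ)) % 2)) := fun n => by
    suffices ∑ k ∈ Finset.range n, (ζ (-1 - k) - 2 * ((-1 - (k : ℤ)) % 2)) =
      ∑ k ∈ Finset.range n, (0 - (1 - ζ (-1 - k))) - (n : ℤ) % 2 by omega
    induction n with
    | zero => simp
    | succ n ih => rw [Finset.sum_range_succ, ih, Finset.sum_range_succ]; push_cast; omega
  obtain ⟨v, hv, hΔ⟩ := exists_nonneg_laplacian_eq (f := fun x => ζ x - 2 * (x % 2))
    (((tendsto_sum_atTop_of_tendsto_average hpos h.right).eventually_ge_atTop 0).mono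
      fun n hn => hn.trans (hr n))
    (((tendsto_sum_atTop_of_tendsto_average hpos h.left).eventually_ge_atTop 1).mono
      fun n hn => by have := hl n; omega)
  exact ⟨v, hW.alternating_sub_le hv hΔ⟩

/-! ### Averages along residue classes -/

theorem sum_range_mul_eq_sum_residues (a : ℕ → ℝ) (m n : ℕ) :
    ∑ k ∈ Finset.range (m * n), a k =
      ∑ r ∈ Finset.range m, ∑ k ∈ Finset.range n, a (r + m * k) := by
  induction n with
  | zero => simp
  | succ n ih =>
    rw [Nat.mul_succ, Finset.sum_range_add, ih]
    simp only [Finset.sum_range_succ, Finset.sum_add_distrib, add_comm]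

theorem tendsto_average_of_residues {a : ℕ → ℝ} (ha : ∀ k, 0 ≤ a k) {m : ℕ} (hm : 0 < m) {p : ℝ}
    (h : ∀ r < m, Tendsto (fun n : ℕ => (∑ k ∈ Finset.range n, a (r + m * k)) / n) atTop (𝓝 p)) :
    Tendsto (fun n : ℕ => (∑ k ∈ Finset.range n, a k) / n) atTop (𝓝 p) := by
  have hm' : (0 : ℝ) < m := by positivity
  refine tendsto_div_of_monotone_of_exists_subseq_tendsto_div _ _
    (fun i j hij => Finset.sum_le_sum_of_subset_of_nonneg (by simpa using hij)
      fun _ _ _ => ha _) fun b hb => ⟨fun n => m * n, ?_, ?_, ?_⟩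
  · filter_upwards [tendsto_natCast_atTop_atTop.eventually_ge_atTop (1 / (b - 1))] with n hn
    have : 1 ≤ n * (b - 1) := (div_le_iff₀ (by linarith)).1 hn
    push_cast
    nlinarith
  · exact tendsto_id.const_mul_atTop' hm
  · have := (tendsto_finsetSum (Finset.range m) fun r hr => h r (Finset.mem_range.1 hr)).div_const
      (m : ℝ)
    rw [Finset.sum_const, Finset.card_range, nsmul_eq_mul, mul_div_cancel_left₀ _ hm'.ne'] at this
    refine this.congr fun n => ?_
    rw [sum_range_mul_eq_sum_residues, ← Finset.sum_div, div_div, Nat.cast_mul, mul_comm (n : ℝ)]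

/-! ### Shifts and locality -/

/-- The configuration seen from `x`. -/
def shift (x : ℤ) (η : ℤ → ℕ) (z : ℤ) : ℕ := η (x + z)

theorem step_shift (x : ℤ) (η : ℤ → ℕ) : step (shift x η) = shift x (step η) := by
  funext z
  simp only [step, shift, Active, add_sub_assoc, add_assoc]
  rfl

theorem evolve_shift (x : ℤ) (η : ℤ → ℕ) (t : ℕ) : evolve t (shift x η) = shift x (evolve t η) := by
  induction t with
  | zero => rfl
  | succ t ih => rw [evolve_succ, ih, step_shift, evolve_succ]

theorem evolve_congr {η η' : ℤ → ℕ} (t : ℕ) (x : ℤ) (h : ∀ z, |z - x| ≤ t → η z = η' z) :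
    evolve t η x = evolve t η' x := by
  induction t generalizing x with
  | zero => exact h x (by simp)
  | succ t ih =>
    have key : ∀ y, |y - x| ≤ 1 → evolve t η y = evolve t η' y := fun y hy =>
      ih y fun z hz => h z (by
        push_cast
        calc |z - x| = |(z - y) + (y - x)| := by ring_nf
          _ ≤ |z - y| + |y - x| := abs_add_le _ _
          _ ≤ t + 1 := add_le_add hz hy)
    simp only [evolve_succ, step, Active, key x (by simp), key (x - 1) (by simp),
      key (x + 1) (by simp)]

theorem measurable_step : Measurable step := by
  refine measurable_pi_lambda _ fun x => ?_
  let g : ℕ × ℕ × ℕ → ℕ := fun p =>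
    (if 2 ≤ p.1 then p.1 - 2 else p.1) + (if 2 ≤ p.2.1 then 1 else 0)
      + (if 2 ≤ p.2.2 then 1 else 0)
  exact (measurable_of_countable g).comp (f := fun η : ℤ → ℕ => (η x, η (x - 1), η (x + 1)))
    ((measurable_pi_apply x).prodMk ((measurable_pi_apply (x - 1)).prodMk
      (measurable_pi_apply (x + 1))))

theorem measurable_evolve (t : ℕ) : Measurable (evolve t) := measurable_step.iterate t

instance (ρ : ℝ≥0) : IsProbabilityMeasure (initialLaw ρ) := by
  unfold initialLaw; infer_instance

theorem measurePreserving_shift (ρ : ℝ≥0) (x : ℤ) :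
    MeasurePreserving (shift x) (initialLaw ρ) (initialLaw ρ) where
  measurable := measurable_pi_lambda _ fun z => measurable_pi_apply (x + z)
  map_eq := Measure.map_infinitePi_infinitePi_of_inj (P := fun _ : ℤ => poissonMeasure ρ)
    (add_right_injective x)

/-! ### Strong laws -/

/-- The observable `F` depends only on the heights in `[-t, t]`. -/
def IsLocal (t : ℕ) (F : (ℤ → ℕ) → ℝ) : Prop :=
  ∀ η η' : ℤ → ℕ, (∀ z : ℤ, |z| ≤ t → η z = η' z) → F η = F η'

theorem indepFun_comp_shift (ρ : ℝ≥0) {F : (ℤ → ℕ) → ℝ} (hF : Measurable F) {t : ℕ}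
    (hloc : IsLocal t F) {x y : ℤ} (hxy : 2 * t < |x - y|) :
    IndepFun (fun η => F (shift x η)) (fun η => F (shift y η)) (initialLaw ρ) := by
  let S : ℤ → Finset ℤ := fun x => Finset.Icc (x - t) (x + t)
  let G : (x : ℤ) → (S x → ℕ) → ℝ := fun x w =>
    F fun z => if h : x + z ∈ S x then w ⟨x + z, h⟩ else 0
  have hG : ∀ x, Measurable (G x) := fun x => hF.comp <| measurable_pi_lambda _ fun z => by
    by_cases h : x + z ∈ S x
    · simpa only [h, dite_true] using measurable_pi_apply _
    · simpa only [h, dite_false] using measurable_const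
  have hFG : ∀ x, (fun η => F (shift x η)) = G x ∘ fun (η : ℤ → ℕ) (i : S x) => η i := fun x => by
    funext η
    refine hloc _ _ fun z hz => ?_
    have : x + z ∈ S x := by
      have := abs_le.1 hz
      simp only [S, Finset.mem_Icc]; omega
    simp [this, shift]
  have hind : iIndepFun (fun (i : ℤ) (η : ℤ → ℕ) => η i) (initialLaw ρ) :=
    iIndepFun_infinitePi (X := fun _ n => n) fun _ => measurable_id
  have hdisj : Disjoint (S x) (S y) := by
    rw [Finset.disjoint_left]
    intro z hz hz'
    simp only [S, Finset.mem_Icc] at hz hz'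
    rcases lt_abs.1 hxy with h | h <;> omega
  rw [hFG x, hFG y]
  exact (hind.indepFun_finset _ _ hdisj fun i => measurable_pi_apply i).comp (hG x) (hG y)

theorem strong_law_shift (ρ : ℝ≥0) {F : (ℤ → ℕ) → ℝ} (hF : Measurable F)
    (hint : Integrable F (initialLaw ρ)) {t : ℕ} (hloc : IsLocal t F) (c : ℤ) {d : ℤ}
    (hd : 2 * t < |d|) :
    ∀ᵐ η ∂(initialLaw ρ), Tendsto
      (fun n : ℕ => (∑ k ∈ Finset.range n, F (shift (c + d * k) η)) / n) atTop
      (𝓝 (∫ η, F η ∂(initialLaw ρ))) := by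
  have hident : ∀ x, IdentDistrib (fun η => F (shift x η)) F (initialLaw ρ) (initialLaw ρ) :=
    fun x => ⟨(hF.comp (measurePreserving_shift ρ x).measurable).aemeasurable, hF.aemeasurable, by
      conv_rhs => rw [← (measurePreserving_shift ρ x).map_eq]
      rw [Measure.map_map hF (measurePreserving_shift ρ x).measurable]; rfl⟩
  have h := strong_law_ae_real (μ := initialLaw ρ) (fun (k : ℕ) η => F (shift (c + d * k) η))
    ((hident _).integrable_iff.2 hint)
    (fun i j hij => indepFun_comp_shift ρ hF hloc (by
      rw [show c + d * (i : ℤ) - (c + d * j) = d * (i - j) by ring, abs_mul]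
      have : 1 ≤ |(i : ℤ) - j| := Int.one_le_abs (by omega)
      nlinarith [abs_nonneg d]))
    (fun i => (hident _).trans (hident _).symm)
  rwa [(hident _).integral_eq] at h

theorem strong_law_halfLine (ρ : ℝ≥0) {F : (ℤ → ℕ) → ℝ} (hF : Measurable F)
    (hint : Integrable F (initialLaw ρ)) (hnonneg : ∀ η, 0 ≤ F η) {t : ℕ} (hloc : IsLocal t F)
    (c : ℤ) {σ : ℤ} (hσ : |σ| = 1) :
    ∀ᵐ η ∂(initialLaw ρ), Tendsto
      (fun n : ℕ => (∑ k ∈ Finset.range n, F (shift (c + σ * k) η)) / n) atTop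
      (𝓝 (∫ η, F η ∂(initialLaw ρ))) := by
  have h : ∀ᵐ η ∂(initialLaw ρ), ∀ r : ℕ, Tendsto
      (fun n : ℕ => (∑ k ∈ Finset.range n,
        F (shift (c + σ * r + σ * (2 * t + 1 : ℕ) * k) η)) / n) atTop
      (𝓝 (∫ η, F η ∂(initialLaw ρ))) :=
    ae_all_iff.2 fun r => strong_law_shift ρ hF hint hloc _ (by
      rw [abs_mul, hσ, one_mul, Nat.abs_cast]; push_cast; omega)
  filter_upwards [h] with η hη
  refine tendsto_average_of_residues (fun k => hnonneg _) (m := 2 * t + 1) (by omega)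
    fun r _ => (hη r).congr fun n => ?_
  congr! 4 with k
  push_cast
  ring_nf

/-! ### The Poisson mean -/

theorem hasSum_poisson_mean (r : ℝ≥0) :
    HasSum (fun n : ℕ => Real.exp (-r) * r ^ n / (n.factorial : ℝ) * n) r := by
  rw [← hasSum_nat_add_iff' 1]
  simp only [Finset.range_one, Finset.sum_singleton, Nat.cast_zero, mul_zero, sub_zero]
  have := (hasSum_one_poissonMeasure r).mul_left (r : ℝ)
  rw [mul_one] at this
  refine this.congr_fun fun n => ?_
  rw [Nat.factorial_succ]
  push_cast
  field_simp
  ring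

theorem integrable_cast_poissonMeasure (r : ℝ≥0) :
    Integrable (fun n : ℕ => (n : ℝ)) (poissonMeasure r) := by
  rw [integrable_poissonMeasure_iff]
  simpa using (hasSum_poisson_mean r).summable

theorem integral_cast_poissonMeasure (r : ℝ≥0) : ∫ n : ℕ, (n : ℝ) ∂(poissonMeasure r) = r := by
  rw [integral_poissonMeasure' (integrable_cast_poissonMeasure r)]
  simpa using (hasSum_poisson_mean r).tsum_eq

theorem ae_hasMean (ρ : ℝ≥0) : ∀ᵐ η ∂(initialLaw ρ), HasMean (fun x => η x) ρ := by
  have hp : MeasurePreserving (fun η : ℤ → ℕ => η 0) (initialLaw ρ) (poissonMeasure ρ) :=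
    measurePreserving_eval_infinitePi (fun _ : ℤ => poissonMeasure ρ) 0
  have hF : Measurable fun η : ℤ → ℕ => (η 0 : ℝ) :=
    measurable_from_nat.comp (measurable_pi_apply 0)
  have hint : Integrable (fun η : ℤ → ℕ => (η 0 : ℝ)) (initialLaw ρ) :=
    hp.integrable_comp_of_integrable (integrable_cast_poissonMeasure ρ)
  have hval : ∫ η : ℤ → ℕ, (η 0 : ℝ) ∂(initialLaw ρ) = ρ := by
    rw [← integral_cast_poissonMeasure ρ, ← hp.map_eq,
      integral_map hp.measurable.aemeasurable (by fun_prop)]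
  have hloc : IsLocal 0 fun η : ℤ → ℕ => (η 0 : ℝ) := fun η η' h => by
    simp only [h 0 (by simp)]
  filter_upwards [strong_law_shift ρ hF hint hloc 0 (d := 1) (by simp),
    strong_law_shift ρ hF hint hloc (-1) (d := -1) (by simp)] with η h1 h2
  rw [hval] at h1 h2
  refine ⟨h1.congr fun n => ?_, h2.congr fun n => ?_⟩
  · simp [shift]
  · simp [shift, sub_eq_add_neg]

/-! ### The activity density -/

/-- The indicator of the event that the origin is active at time `t`. -/
noncomputable def activity (t : ℕ) (η : ℤ → ℕ) : ℝ := if Active (evolve t η) 0 then 1 else 0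

theorem activity_nonneg (t : ℕ) (η : ℤ → ℕ) : 0 ≤ activity t η := by
  unfold activity; split_ifs <;> norm_num

theorem activity_le_one (t : ℕ) (η : ℤ → ℕ) : activity t η ≤ 1 := by
  unfold activity; split_ifs <;> norm_num

theorem measurable_activity (t : ℕ) : Measurable (activity t) := by
  have : Measurable fun n : ℕ => if 2 ≤ n then (1 : ℝ) else 0 := measurable_from_nat
  exact this.comp ((measurable_pi_apply 0).comp (measurable_evolve t))

theorem norm_activity_le_one (t : ℕ) (η : ℤ → ℕ) : ‖activity t η‖ ≤ 1 := by
  rw [Real.norm_of_nonneg (activity_nonneg t η)]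
  exact activity_le_one t η

theorem integrable_activity (ρ : ℝ≥0) (t : ℕ) : Integrable (activity t) (initialLaw ρ) :=
  .of_bound (measurable_activity t).aestronglyMeasurable 1 (.of_forall (norm_activity_le_one t))

theorem isLocal_activity (t : ℕ) : IsLocal t (activity t) := fun η η' h => by
  simp only [activity, Active, evolve_congr t 0 fun z hz => h z (by simpa using hz)]

theorem activity_shift (t : ℕ) (x : ℤ) (η : ℤ → ℕ) :
    activity t (shift x η) = if Active (evolve t η) x then 1 else 0 := by
  simp [activity, evolve_shift, shift, Active]

theorem sum_range_activity (η : ℤ → ℕ) (t : ℕ) :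
    ∑ s ∈ Finset.range t, activity s η = odometer η t 0 := by
  simp [odometer, activity]

theorem activeFraction_eq (n : ℕ) (η : ℤ → ℕ) : activeFraction n η =
    (∑ k ∈ Finset.range (n + 1), (if Active η k then (1 : ℝ) else 0) +
      ∑ k ∈ Finset.range n, (if Active η (-1 - k) then (1 : ℝ) else 0)) / (2 * n + 1) := by
  unfold activeFraction
  congr 1
  rw [Finset.card_filter]
  push_cast
  induction n with
  | zero => rw [Nat.cast_zero, neg_zero, Finset.Icc_self]; simp only [Finset.sum_singleton,
      zero_add, Finset.sum_range_one, Finset.sum_range_zero, add_zero, Nat.cast_zero]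
  | succ n ih =>
    have hI : Finset.Icc (-((n + 1 : ℕ) : ℤ)) (n + 1 : ℕ) =
        insert ((n + 1 : ℕ) : ℤ) (insert (-1 - (n : ℤ)) (Finset.Icc (-(n : ℤ)) n)) := by
      ext z; simp only [Finset.mem_insert, Finset.mem_Icc]; omega
    rw [hI, Finset.sum_insert (by simp only [Finset.mem_insert, Finset.mem_Icc]; omega),
      Finset.sum_insert (by simp only [Finset.mem_Icc]; omega), ih,
      Finset.sum_range_succ _ (n + 1),
      Finset.sum_range_succ (fun k : ℕ => if Active η (-1 - k) then (1 : ℝ) else 0) n]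
    ring

theorem isActivityDensity_integral (ρ : ℝ≥0) (t : ℕ) :
    IsActivityDensity ρ t (∫ η, activity t η ∂(initialLaw ρ)) := by
  have hlaw := fun c σ => strong_law_halfLine ρ (measurable_activity t) (integrable_activity ρ t)
    (activity_nonneg t) (isLocal_activity t) c (σ := σ)
  unfold IsActivityDensity
  filter_upwards [hlaw 0 1 (by simp), hlaw (-1) (-1) (by simp)] with η hr hl
  set p := ∫ η, activity t η ∂(initialLaw ρ)
  simp only [activity_shift, zero_add, one_mul, neg_mul, ← sub_eq_add_neg] at hr hl
  have h1 : Tendsto (fun n : ℕ => ((n : ℝ) + 1) / (2 * n + 1)) atTop (𝓝 (1 / 2)) := by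
    have h := (tendsto_natCast_div_add_atTop (𝕜 := ℝ) (1 / 2)).const_mul (1 / 2)
    have h' : Tendsto (fun n : ℕ => 1 - (1 / 2) * ((n : ℝ) / (n + 1 / 2))) atTop
        (𝓝 (1 - 1 / 2 * 1)) := h.const_sub 1
    rw [show (1 : ℝ) - 1 / 2 * 1 = 1 / 2 by norm_num] at h'
    refine h'.congr fun n => ?_
    field_simp
    ring
  have h2 : Tendsto (fun n : ℕ => (n : ℝ) / (2 * n + 1)) atTop (𝓝 (1 / 2)) := by
    have h' := h1.const_sub 1
    rw [show (1 : ℝ) - 1 / 2 = 1 / 2 by norm_num] at h'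
    refine h'.congr fun n => ?_
    field_simp
    ring
  have h := ((hr.comp (tendsto_add_atTop_nat 1)).mul h1).add (hl.mul h2)
  rw [show p * (1 / 2) + p * (1 / 2) = p by ring] at h
  refine h.congr' ?_
  filter_upwards [eventually_gt_atTop 0] with n hn
  have : (n : ℝ) ≠ 0 := by positivity
  rw [activeFraction_eq]
  simp only [Function.comp_apply, Nat.cast_add, Nat.cast_one]
  field_simp

/-! ### Long-time limits -/

theorem tendsto_activity_zero {η : ℤ → ℕ} {m : ℝ} (hm : HasMean (fun x => η x) m) (h1 : m < 1) :
    Tendsto (fun t => activity t η) atTop (𝓝 0) := by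
  obtain ⟨v, hv⟩ := (isOdometer_odometer η).exists_bound hm h1
  refine (summable_of_sum_range_le (c := v 0) (fun t => activity_nonneg t η)
    fun t => ?_).tendsto_atTop_zero
  rw [sum_range_activity]
  exact_mod_cast hv t 0

theorem tendsto_activity_one {η : ℤ → ℕ} {m : ℝ} (hm : HasMean (fun x => η x) m) (h2 : 2 < m) :
    Tendsto (fun t => activity t η) atTop (𝓝 1) := by
  obtain ⟨v, hv⟩ := (isOdometer_idle η).exists_bound (hm.const_sub 3) (by push_cast; linarith)
  have h : Tendsto (fun t => 1 - activity t η) atTop (𝓝 0) := by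
    refine (summable_of_sum_range_le (c := v 0) (fun t => sub_nonneg.2 (activity_le_one t η))
      fun t => ?_).tendsto_atTop_zero
    rw [Finset.sum_sub_distrib, sum_range_activity]
    simp only [Finset.sum_const, Finset.card_range, nsmul_eq_mul, mul_one]
    exact_mod_cast hv t 0
  simpa using h.const_sub 1

theorem tendsto_average_activity {η : ℤ → ℕ} {m : ℝ} (hm : HasMean (fun x => η x) m)
    (h1 : 1 < m) (h2 : m < 2) :
    Tendsto (fun T : ℕ => (∑ t ∈ Finset.range T, activity t η) / T) atTop (𝓝 (1 / 2)) := by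
  obtain ⟨v, hv⟩ := (isOdometer_odometer η).exists_half_le hm h1
  obtain ⟨w, hw⟩ := (isOdometer_idle η).exists_half_le (hm.const_sub 3) (by push_cast; linarith)
  have hlo : ∀ T : ℕ, (T : ℝ) / 2 - (v 0 + 1) ≤ odometer η T 0 := fun T => by
    have : (T : ℤ) ≤ 2 * (odometer η T 0 + v 0 + 1) := by have := hv T 0; omega
    have : (T : ℝ) ≤ 2 * (odometer η T 0 + v 0 + 1) := by exact_mod_cast this
    linarith
  have hhi : ∀ T : ℕ, odometer η T 0 ≤ (T : ℝ) / 2 + (w 0 + 1) := fun T => by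
    have : 2 * odometer η T 0 ≤ T + 2 * (w 0 + 1) := by have := hw T 0; omega
    have : (2 : ℝ) * odometer η T 0 ≤ T + 2 * (w 0 + 1) := by exact_mod_cast this
    linarith
  have l1 : Tendsto (fun T : ℕ => 1 / 2 - ((v 0 : ℝ) + 1) / T) atTop (𝓝 (1 / 2)) := by
    simpa only [sub_zero] using
      (tendsto_const_div_atTop_nhds_zero_nat ((v 0 : ℝ) + 1)).const_sub (1 / 2)
  have l2 : Tendsto (fun T : ℕ => 1 / 2 + ((w 0 : ℝ) + 1) / T) atTop (𝓝 (1 / 2)) := by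
    simpa only [add_zero] using
      (tendsto_const_div_atTop_nhds_zero_nat ((w 0 : ℝ) + 1)).const_add (1 / 2)
  refine tendsto_of_tendsto_of_tendsto_of_le_of_le' l1 l2 ?_ ?_
  · filter_upwards [eventually_gt_atTop 0] with T hT
    have hT' : (0 : ℝ) < T := by positivity
    rw [sum_range_activity, le_div_iff₀ hT']
    have := hlo T
    field_simp at this ⊢
    linarith
  · filter_upwards [eventually_gt_atTop 0] with T hT
    have hT' : (0 : ℝ) < T := by positivity
    rw [sum_range_activity, div_le_iff₀ hT']
    have := hhi T
    field_simp at this ⊢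
    linarith

theorem tendsto_integral_activity {ρ : ℝ≥0} {l : ℝ}
    (h : ∀ᵐ η ∂(initialLaw ρ), Tendsto (fun t => activity t η) atTop (𝓝 l)) :
    Tendsto (fun t => ∫ η, activity t η ∂(initialLaw ρ)) atTop (𝓝 l) := by
  simpa using tendsto_integral_of_dominated_convergence (fun _ => 1)
    (fun t => (measurable_activity t).aestronglyMeasurable) (integrable_const 1)
    (fun t => .of_forall (norm_activity_le_one t)) h

theorem tendsto_average_integral_activity {ρ : ℝ≥0} (h1 : 1 < ρ) (h2 : ρ < 2) :
    Tendsto (fun T : ℕ => (∑ t ∈ Finset.range T, ∫ η, activity t η ∂(initialLaw ρ)) / T) atTop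
      (𝓝 (1 / 2)) := by
  have h : ∀ᵐ η ∂(initialLaw ρ), Tendsto
      (fun T : ℕ => (∑ t ∈ Finset.range T, activity t η) / T) atTop (𝓝 (1 / 2)) :=
    (ae_hasMean ρ).mono fun η hη =>
      tendsto_average_activity hη (by exact_mod_cast h1) (by exact_mod_cast h2)
  have hlim := tendsto_integral_of_dominated_convergence (fun _ => 1)
    (fun T => ((Finset.measurable_sum _ fun t _ => measurable_activity t).div_const
      (T : ℝ)).aestronglyMeasurable) (integrable_const 1)
    (fun T => .of_forall fun η => by
      rw [Real.norm_of_nonneg (div_nonneg (Finset.sum_nonneg fun t _ => activity_nonneg t η)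
        T.cast_nonneg)]
      refine div_le_one_of_le₀ ?_ T.cast_nonneg
      simpa using Finset.sum_le_sum fun t (_ : t ∈ Finset.range T) => activity_le_one t η) h
  simpa [integral_div, integral_finsetSum, integrable_activity] using hlim

theorem tendsto_average_Icc {a : ℕ → ℝ} {l : ℝ}
    (h : Tendsto (fun T : ℕ => (∑ t ∈ Finset.range T, a t) / T) atTop (𝓝 l)) :
    Tendsto (fun T : ℕ => (1 / (T : ℝ)) * ∑ t ∈ Finset.Icc 1 T, a t) atTop (𝓝 l) := by
  have h' := ((h.comp (tendsto_add_atTop_nat 1)).div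
    (tendsto_natCast_div_add_atTop (𝕜 := ℝ) 1) one_ne_zero).sub
    (tendsto_const_div_atTop_nhds_zero_nat (a 0))
  rw [div_one, sub_zero] at h'
  refine h'.congr' ?_
  filter_upwards [eventually_gt_atTop 0] with T hT
  have : (T : ℝ) ≠ 0 := by positivity
  have hs : ∑ t ∈ Finset.range (T + 1), a t = a 0 + ∑ t ∈ Finset.Icc 1 T, a t := by
    rw [Finset.range_eq_Ico, Finset.sum_eq_sum_Ico_succ_bot (by omega)]
    rfl
  simp only [Function.comp_apply, Pi.div_apply, Nat.cast_add, Nat.cast_one, hs]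
  field_simp
  ring

end Sandpile

theorem mainTheorem4 :
    ∃ α : ℝ≥0 → ℕ → ℝ,
      (∀ (ρ : ℝ≥0) (t : ℕ), Sandpile.IsActivityDensity ρ t (α ρ t)) ∧
      (∀ ρ : ℝ≥0, ρ < 1 → Tendsto (fun t : ℕ => α ρ t) atTop (𝓝 0)) ∧
      (∀ ρ : ℝ≥0, 2 < ρ → Tendsto (fun t : ℕ => α ρ t) atTop (𝓝 1)) ∧
      (∀ ρ : ℝ≥0, 1 < ρ → ρ < 2 →
        Tendsto (fun T : ℕ => (1 / (T : ℝ)) * ∑ t ∈ Finset.Icc 1 T, α ρ t)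
          atTop (𝓝 (1 / 2))) := by
  refine ⟨fun ρ t => ∫ η, Sandpile.activity t η ∂(Sandpile.initialLaw ρ),
    Sandpile.isActivityDensity_integral, fun ρ h => ?_, fun ρ h => ?_, fun ρ h1 h2 => ?_⟩
  · exact Sandpile.tendsto_integral_activity <| (Sandpile.ae_hasMean ρ).mono fun η hη =>
      Sandpile.tendsto_activity_zero hη (by exact_mod_cast h)
  · exact Sandpile.tendsto_integral_activity <| (Sandpile.ae_hasMean ρ).mono fun η hη =>
      Sandpile.tendsto_activity_one hη (by exact_mod_cast h)
  · exact Sandpile.tendsto_average_Icc (Sandpile.tendsto_average_integral_activity h1 h2)
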